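/- Let $f:\mathbb{R}^n\to\mathbb{R}^n$ be a continuous vector field for which every initial value problem $x'=f(x)$, $x(0)=x_0$, has a unique local solution. Write $\varphi(\cdot,x)$ for the solution starting at $x$ and $I_x\ni 0$ for its maximal interval of existence. For $S\subseteq\mathbb{R}^n$ put $$\mathrm{In}_f(S)=\{x\in\mathbb{R}^n \mid \exists\,\varepsilon\in I_x\cap(0,\infty).\ \forall t\in(0,\varepsilon).\ \varphi(t,x)\in S\},$$ $$\mathrm{Exit}_f(S)=\{x\in S \mid \forall\, t\in I_x\cap(0,\infty).\ \exists s\in(0,t).\ \varphi(s,x)\notin S\}.$$ A set $S\subseteq\mathbb{R}^n$ is semi-analytic if every $a\in\mathbb{R}^n$ has an open neighbourhood $U$ such that $S\cap U$ is a finite union of sets, each described within $U$ by finitely many conditions $p<0$ and $q=0$ with $p,q$ real analytic on $U$. Let ${}^c$ denote the complement in $\mathbb{R}^n$. 1. If $f$ is real analytic on $\mathbb{R}^n$ and $S_1,S_2\subseteq\mathbb{R}^n$ are semi-analytic, then $$\mathrm{Exit}_f(S_1\cup S_2)=\bigl(\mathrm{Exit}_f(S_1)\cap \mathrm{In}_f(S_2)^c\bigr)\cup\bigl(\mathrm{In}_f(S_1)^c\cap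 \mathrm{Exit}_f(S_2)\bigr).$$ 2. For every $f$ as in the first sentence and arbitrary sets $S_1,S_2\subseteq\mathbb{R}^n$, $$\mathrm{Exit}_f(S_1\cup S_2)\subseteq\bigl(\mathrm{Exit}_f(S_1)\cap \mathrm{In}_f(S_2)^c\bigr)\cup\bigl(\mathrm{In}_f(S_1)^c\cap \mathrm{Exit}_f(S_2)\bigr).$$ 3. The reverse inclusion in 2 fails in general: already for the system $x'=1$ on $\mathbb{R}$ there are sets $S_1,S_2\subseteq\mathbb{R}$ for which it does not hold. -/

import Mathlib

/-- `γ` solves the initial value problem `x' = f(x)`, `x(0) = x` on the open interval `(a, b) ∋ 0`. -/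
def IsSolution {E : Type*} [NormedAddCommGroup E] [NormedSpace ℝ E]
    (f : E → E) (x : E) (a b : ℝ) (γ : ℝ → E) : Prop :=
  a < 0 ∧ 0 < b ∧ γ 0 = x ∧ ∀ t ∈ Set.Ioo a b, HasDerivAt γ (f (γ t)) t

/-- Every initial value problem for `x' = f(x)` has a local solution, and solutions are unique:
two solutions with the same initial value agree on every common interval of definition. -/
def HasUniqueSolutions {E : Type*} [NormedAddCommGroup E] [NormedSpace ℝ E] (f : E → E) : Prop :=
  ∀ x : E, (∃ a b γ, IsSolution f x a b γ) ∧
    ∀ a b γ₁ γ₂, IsSolution f x a b γ₁ → IsSolution f x a b γ₂ → Set.EqOn γ₁ γ₂ (Set.Ioo a b)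

/-- The maximal interval of existence `I_x`: the union of all open intervals around `0` on which
the initial value problem has a solution. -/
def maxInterval {E : Type*} [NormedAddCommGroup E] [NormedSpace ℝ E] (f : E → E) (x : E) : Set ℝ :=
  {t | ∃ γ : ℝ → E, ∃ a b, t ∈ Set.Ioo a b ∧ IsSolution f x a b γ}

open Classical in
/-- The local flow `φ(t, x)`: the value at time `t` of a solution starting at `x`. By uniqueness of
solutions it does not depend on the solution chosen. It is meaningful for `t ∈ maxInterval f x`;
outside this interval it takes the irrelevant value `x`. -/
noncomputable def flow {E : Type*} [NormedAddCommGroup E] [NormedSpace ℝ E]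
    (f : E → E) (t : ℝ) (x : E) : E :=
  if h : t ∈ maxInterval f x then h.choose t else x

/-- `In_f(S)`: the points from which the flow stays in `S` during some interval `(0, ε)`,
where `ε > 0` ranges over the maximal interval of existence. -/
def inSet {E : Type*} [NormedAddCommGroup E] [NormedSpace ℝ E] (f : E → E) (S : Set E) : Set E :=
  {x | ∃ ε ∈ maxInterval f x, 0 < ε ∧ ∀ t ∈ Set.Ioo 0 ε, flow f t x ∈ S}

/-- `Exit_f(S)`: the points of `S` from which the flow leaves `S` immediately; here `t > 0` ranges
over the maximal interval of existence. -/
def exitSet {E : Type*} [NormedAddCommGroup E] [NormedSpace ℝ E] (f : E → E) (S : Set E) : Set E :=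
  {x | x ∈ S ∧ ∀ t ∈ maxInterval f x, 0 < t → ∃ s ∈ Set.Ioo 0 t, flow f s x ∉ S}

/-- `S` is semi-analytic: every point `a` of the ambient space (not only of `S`) has an open
neighbourhood `U` on which `S` is a finite union of sets, each described by finitely many
conditions `p < 0` and `q = 0` with `p`, `q` real analytic on `U`. -/
def IsSemianalytic {E : Type*} [NormedAddCommGroup E] [NormedSpace ℝ E] (S : Set E) : Prop :=
  ∀ a : E, ∃ U : Set E, IsOpen U ∧ a ∈ U ∧
    ∃ C : Finset (Finset (E → ℝ) × Finset (E → ℝ)),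
      (∀ c ∈ C, (∀ p ∈ c.1, AnalyticOnNhd ℝ p U) ∧ (∀ q ∈ c.2, AnalyticOnNhd ℝ q U)) ∧
      ∀ y ∈ U, (y ∈ S ↔ ∃ c ∈ C, (∀ p ∈ c.1, p y < 0) ∧ (∀ q ∈ c.2, q y = 0))

/-!
`Exit S` is `S \ In S`, so the right-hand side of the formula is `(S₁ ∪ S₂) \ (In S₁ ∪ In S₂)`.
The inclusion is therefore the monotonicity of `In`, and equality holds as soon as
`In (S₁ ∪ S₂) = In S₁ ∪ In S₂`. The latter is true when, along each flow line, membership in one of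
the two sets is eventually constant as `t → 0⁺`: then the flow line is either eventually in that
set, or eventually in the other one.

Membership in a semi-analytic set is eventually constant along every analytic curve, because an
analytic function of one variable that vanishes, or is negative, arbitrarily close to the right of a
point does so on a whole interval to the right of it. Integral curves of an analytic field `f` are
analytic: the `k`-th derivative of `γ` is the `k`-fold Lie derivative of the identity along `f`,
evaluated on `γ`, and Cauchy estimates for `f` bound it by `A * C ^ k * k!`.

If `f x ≠ 0`, some linear functional has nonzero derivative along the flow line of `x`, so by the
intermediate value theorem it takes both rational and irrational values arbitrarily soon. The
preimage of `ℚ` and its complement then violate the reverse inclusion: `x` lies in neither `In`, but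
nothing leaves their union.
-/

open Filter Set
open scoped ContDiff ENNReal Interval Manifold NNReal Nat Topology

section CauchyEstimates

variable {E F : Type*} [NormedAddCommGroup E] [NormedSpace ℝ E]
  [NormedAddCommGroup F] [NormedSpace ℝ F]

theorem exists_forall_nnnorm_changeOrigin_mul_pow_le (p : FormalMultilinearSeries ℝ E F)
    {r r' : ℝ≥0} (h : (r + r' : ℝ≥0∞) < p.radius) :
    ∃ M : ℝ≥0, ∀ y : E, ‖y‖₊ ≤ r → ∀ k, ‖p.changeOrigin y k‖₊ * r' ^ k ≤ M := by
  refine ⟨∑' s : Σ k l : ℕ, { s : Finset (Fin (k + l)) // s.card = l },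
    ‖p (s.1 + s.2.1)‖₊ * r ^ s.2.1 * r' ^ s.1, fun y hy k => ?_⟩
  have hr : (r : ℝ≥0∞) < p.radius := le_self_add.trans_lt h
  have hy' : (‖y‖₊ : ℝ≥0∞) < p.radius := (ENNReal.coe_le_coe.2 hy).trans_lt hr
  have hnorm : ‖p.changeOrigin y k‖₊ ≤
      ∑' s : Σ l : ℕ, { s : Finset (Fin (k + l)) // s.card = l }, ‖p (k + s.1)‖₊ * r ^ s.1 :=
    (p.nnnorm_changeOrigin_le k hy').trans <|
      (p.changeOriginSeries_summable_aux₂ hy' k).tsum_le_tsum (fun s => by gcongr)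
        (p.changeOriginSeries_summable_aux₂ hr k)
  have hfiber := NNReal.tsum_comp_le_tsum_of_inj (p.changeOriginSeries_summable_aux₁ h)
    (sigma_mk_injective (i := k))
  simp only [NNReal.tsum_mul_right] at hfiber
  exact (mul_le_mul_left hnorm _).trans hfiber

theorem norm_iteratedFDeriv_le_factorial_mul_of_hasFPowerSeriesOnBall [CompleteSpace F]
    {f : E → F} {p : FormalMultilinearSeries ℝ E F} {x : E} {r : ℝ≥0∞}
    (h : HasFPowerSeriesOnBall f p x r) (n : ℕ) :
    ‖iteratedFDeriv ℝ n f x‖ ≤ n ! * ‖p n‖ := by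
  refine ContinuousMultilinearMap.opNorm_le_bound (by positivity) fun v => ?_
  rw [h.iteratedFDeriv_eq_sum_of_completeSpace v]
  calc ‖∑ σ : Equiv.Perm (Fin n), p n fun i => v (σ i)‖
      ≤ ∑ _σ : Equiv.Perm (Fin n), ‖p n‖ * ∏ i, ‖v i‖ :=
        norm_sum_le_of_le _ fun σ _ => ((p n).le_opNorm _).trans_eq <| by
          rw [Equiv.prod_comp σ fun i => ‖v i‖]
    _ = n ! * ‖p n‖ * ∏ i, ‖v i‖ := by
        rw [Finset.sum_const, Finset.card_univ, Fintype.card_perm, Fintype.card_fin,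
          nsmul_eq_mul, mul_assoc]

/-- Cauchy estimates of type `(A, R, k)` for `u` on `V`: the derivatives of `u` of order `m` are
bounded on `V` by `A * R ^ m * (m + k)!`. The shift `k` counts how many derivatives have already
been taken to produce `u`. -/
def HasCauchyEstimatesOn (u : E → F) (V : Set E) (A R : ℝ) (k : ℕ) : Prop :=
  ∀ y ∈ V, ∀ m : ℕ, ‖iteratedFDeriv ℝ m u y‖ ≤ A * R ^ m * (m + k)!

namespace HasCauchyEstimatesOn

variable {u : E → F} {V : Set E} {A R : ℝ} {k : ℕ}

theorem nonneg (h : HasCauchyEstimatesOn u V A R k) {y : E} (hy : y ∈ V) : 0 ≤ A := by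
  have := (norm_nonneg _).trans (h y hy 0)
  simp only [pow_zero, mul_one] at this
  exact nonneg_of_mul_nonneg_left this (by positivity)

theorem mono (h : HasCauchyEstimatesOn u V A R k) {W : Set E} (hW : W ⊆ V) {R' : ℝ}
    (hR : 0 ≤ R) (hR' : R ≤ R') : HasCauchyEstimatesOn u W A R' k := fun y hy m => by
  have hA := h.nonneg (hW hy)
  exact (h y (hW hy) m).trans (by gcongr)

end HasCauchyEstimatesOn

theorem exists_hasCauchyEstimatesOn_of_analyticAt [CompleteSpace F] {u : E → F} {x : E}
    (hu : AnalyticAt ℝ u x) :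
    ∃ A R : ℝ, 0 < R ∧ ∃ V ∈ 𝓝 x, HasCauchyEstimatesOn u V A R 0 := by
  obtain ⟨p, ρ, hp⟩ := hu
  obtain ⟨r, hr0, hr⟩ := ENNReal.lt_iff_exists_nnreal_btwn.1 hp.r_pos
  replace hr0 : 0 < r := ENNReal.coe_pos.1 hr0
  have hrad : ((r / 2 : ℝ≥0) + (r / 2 : ℝ≥0) : ℝ≥0∞) < p.radius := by
    rw [← ENNReal.coe_add, add_halves]
    exact hr.trans_le hp.r_le
  obtain ⟨M, hM⟩ := exists_forall_nnnorm_changeOrigin_mul_pow_le p hrad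
  refine ⟨M, (r / 2 : ℝ)⁻¹, by positivity, Metric.ball x (r / 2),
    Metric.ball_mem_nhds x (by positivity), fun y hy m => ?_⟩
  have hyr : ‖y - x‖₊ < r / 2 := by
    rwa [← NNReal.coe_lt_coe, coe_nnnorm, ← dist_eq_norm]
  have hq : HasFPowerSeriesOnBall u (p.changeOrigin (y - x)) y (ρ - ‖y - x‖₊) := by
    simpa only [add_sub_cancel] using hp.changeOrigin
      ((ENNReal.coe_lt_coe.2 (hyr.trans (half_lt_self hr0))).trans hr)
  have hcoeff : ‖p.changeOrigin (y - x) m‖ ≤ M * (r / 2 : ℝ)⁻¹ ^ m := by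
    rw [inv_pow, ← div_eq_mul_inv, le_div_iff₀ (by positivity)]
    exact_mod_cast hM _ hyr.le m
  calc ‖iteratedFDeriv ℝ m u y‖
      ≤ m ! * ‖p.changeOrigin (y - x) m‖ :=
        norm_iteratedFDeriv_le_factorial_mul_of_hasFPowerSeriesOnBall hq m
    _ ≤ m ! * (M * (r / 2 : ℝ)⁻¹ ^ m) := by gcongr
    _ = M * (r / 2 : ℝ)⁻¹ ^ m * (m + 0)! := by rw [add_zero]; ring

end CauchyEstimates

section LieDerivative

variable {E F : Type*} [NormedAddCommGroup E] [NormedSpace ℝ E]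
  [NormedAddCommGroup F] [NormedSpace ℝ F] {f : E → E} {u : E → F} {V : Set E}

/-- The Lie derivative of `u` along the vector field `f`. Iterating it gives the successive time
derivatives of `u` along the integral curves of `f`. -/
noncomputable def lieDeriv (f : E → E) (u : E → F) : E → F := fun y => fderiv ℝ u y (f y)

theorem contDiffOn_lieDeriv (hV : IsOpen V) (hf : ContDiffOn ℝ ∞ f V) (hu : ContDiffOn ℝ ∞ u V) :
    ContDiffOn ℝ ∞ (lieDeriv f u) V :=
  (hu.fderiv_of_isOpen hV le_rfl).clm_apply hf

theorem contDiffOn_iterate_lieDeriv (hV : IsOpen V) (hf : ContDiffOn ℝ ∞ f V)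
    (hu : ContDiffOn ℝ ∞ u V) (k : ℕ) : ContDiffOn ℝ ∞ ((lieDeriv f)^[k] u) V := by
  induction k with
  | zero => exact hu
  | succ k ih =>
    rw [Function.iterate_succ_apply']
    exact contDiffOn_lieDeriv hV hf ih

theorem choose_mul_factorial_mul_factorial_add_le {n i : ℕ} (hi : i ≤ n) (k : ℕ) :
    n.choose i * (n - i)! * (i + k)! ≤ (n + k)! :=
  calc n.choose i * (n - i)! * (i + k)!
      = (i + k)! * n.descFactorial (n - i) := by
        rw [Nat.descFactorial_eq_factorial_mul_choose, Nat.choose_symm hi]; ring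
    _ ≤ (i + k)! * (n + k).descFactorial (n - i) := by
        gcongr; exact Nat.le_add_right n k
    _ = (n + k)! := by
        rw [← Nat.factorial_mul_descFactorial (show n - i ≤ n + k by lia)]
        congr 2; lia

theorem sum_range_one_half_pow_sub_le_two (n : ℕ) :
    ∑ i ∈ Finset.range (n + 1), (1 / 2 : ℝ) ^ (n - i) ≤ 2 :=
  (Finset.sum_range_reflect (fun i => (1 / 2 : ℝ) ^ i) (n + 1)).trans_le
    (sum_geometric_two_le (n + 1))

namespace HasCauchyEstimatesOn

variable {A M R : ℝ} {k : ℕ}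

/- Giving `f` half the rate of `u` leaves a factor `(1 / 2) ^ (m - i)` in the Leibniz sum, so a Lie
derivative multiplies the constant `A` by `2 * M * R` and does not change the rate `R`. -/
theorem leibniz_term_le (hu : HasCauchyEstimatesOn u V A R k)
    (hf : HasCauchyEstimatesOn f V M (R / 2) 0) (hR : 0 ≤ R) {y : E} (hy : y ∈ V) {m i : ℕ}
    (hi : i ≤ m) :
    m.choose i * ‖iteratedFDeriv ℝ (i + 1) u y‖ * ‖iteratedFDeriv ℝ (m - i) f y‖ ≤
      A * M * R ^ (m + 1) * (m + (k + 1))! * (1 / 2) ^ (m - i) := by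
  have hA := hu.nonneg hy
  have hM := hf.nonneg hy
  have hfact : (m.choose i * (m - i)! * (i + (k + 1))! : ℝ) ≤ (m + (k + 1))! := by
    exact_mod_cast choose_mul_factorial_mul_factorial_add_le hi (k + 1)
  obtain ⟨j, rfl⟩ := Nat.exists_eq_add_of_le hi
  rw [Nat.add_sub_cancel_left] at hfact ⊢
  calc _ ≤ (i + j).choose i * (A * R ^ (i + 1) * (i + 1 + k)!) *
          (M * (R / 2) ^ j * (j + 0)!) := by
        gcongr
        exacts [hu y hy (i + 1), hf y hy j]
    _ = A * M * R ^ (i + j + 1) * ((i + j).choose i * j ! * (i + (k + 1))!) *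
          (1 / 2) ^ j := by
        rw [div_pow, one_div, inv_pow, add_zero, add_right_comm i 1 k, add_assoc i k 1]; ring
    _ ≤ _ := by gcongr

protected theorem lieDeriv (hu : HasCauchyEstimatesOn u V A R k)
    (hf : HasCauchyEstimatesOn f V M (R / 2) 0) (hR : 0 ≤ R) (hV : IsOpen V)
    (hfV : ContDiffOn ℝ ∞ f V) (huV : ContDiffOn ℝ ∞ u V) :
    HasCauchyEstimatesOn (lieDeriv f u) V (A * (2 * M * R)) R (k + 1) := by
  intro y hy m
  have hA := hu.nonneg hy
  have hM := hf.nonneg hy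
  have hleibniz := norm_iteratedFDerivWithin_clm_apply (huV.fderiv_of_isOpen hV le_rfl) hfV
    hV.uniqueDiffOn hy (n := m) (mod_cast le_top)
  simp only [iteratedFDerivWithin_of_isOpen _ hV hy, norm_iteratedFDeriv_fderiv] at hleibniz
  calc ‖iteratedFDeriv ℝ m (lieDeriv f u) y‖
      ≤ ∑ i ∈ Finset.range (m + 1),
          A * M * R ^ (m + 1) * (m + (k + 1))! * (1 / 2) ^ (m - i) :=
        hleibniz.trans <| Finset.sum_le_sum fun i hi =>
          hu.leibniz_term_le hf hR hy (Finset.mem_range_succ_iff.1 hi)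
    _ = A * M * R ^ (m + 1) * (m + (k + 1))! *
          ∑ i ∈ Finset.range (m + 1), (1 / 2) ^ (m - i) := (Finset.mul_sum ..).symm
    _ ≤ A * M * R ^ (m + 1) * (m + (k + 1))! * 2 := by
        gcongr
        exact sum_range_one_half_pow_sub_le_two m
    _ = A * (2 * M * R) * R ^ m * (m + (k + 1))! := by ring

theorem iterate_lieDeriv (hu : HasCauchyEstimatesOn u V A R 0)
    (hf : HasCauchyEstimatesOn f V M (R / 2) 0) (hR : 0 ≤ R) (hV : IsOpen V)
    (hfV : ContDiffOn ℝ ∞ f V) (huV : ContDiffOn ℝ ∞ u V) (k : ℕ) :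
    HasCauchyEstimatesOn ((lieDeriv f)^[k] u) V (A * (2 * M * R) ^ k) R k := by
  induction k with
  | zero => simpa using hu
  | succ k ih =>
    rw [Function.iterate_succ_apply', pow_succ, ← mul_assoc]
    exact ih.lieDeriv hf hR hV hfV (contDiffOn_iterate_lieDeriv hV hfV huV k)

end HasCauchyEstimatesOn

end LieDerivative

section OneVariable

variable {F : Type*} [NormedAddCommGroup F] [NormedSpace ℝ F] [CompleteSpace F] {g : ℝ → F}

theorem norm_sub_sum_iteratedDeriv_le {x₀ x K : ℝ} {n : ℕ}
    (hg : ∀ t ∈ [[x₀, x]], ContDiffAt ℝ (n + 1 : ℕ) g t)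
    (hK : ∀ t ∈ [[x₀, x]], ‖iteratedDeriv (n + 1) g t‖ ≤ K) :
    ‖g x - ∑ k ∈ Finset.range (n + 1), ((k ! : ℝ)⁻¹ * (x - x₀) ^ k) • iteratedDeriv k g x₀‖ ≤
      K / n ! * |x - x₀| ^ (n + 1) := by
  rcases eq_or_ne x₀ x with rfl | hne
  · simp [Finset.sum_range_succ']
  have hderiv : ∀ k ≤ n + 1, ∀ t ∈ [[x₀, x]],
      iteratedDerivWithin k g [[x₀, x]] t = iteratedDeriv k g t := fun k hk t ht =>
    iteratedDerivWithin_eq_iteratedDeriv (uniqueDiffOn_uIcc hne)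
      ((hg t ht).of_le (mod_cast hk)) ht
  have htaylor : g x - ∑ k ∈ Finset.range (n + 1),
      ((k ! : ℝ)⁻¹ * (x - x₀) ^ k) • iteratedDeriv k g x₀ =
        ∫ t in x₀..x, ((x - t) ^ n / n !) • iteratedDerivWithin (n + 1) g [[x₀, x]] t := by
    rw [← taylor_integral_remainder fun t ht => (hg t ht).contDiffWithinAt, taylor_within_apply]
    congr 1
    exact Finset.sum_congr rfl fun k hk => by
      rw [hderiv k (Finset.mem_range.1 hk).le x₀ left_mem_uIcc]
  have : 0 ≤ K := (norm_nonneg _).trans (hK x₀ left_mem_uIcc)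
  rw [htaylor]
  calc _ ≤ |x - x₀| ^ n / n ! * K * |x - x₀| :=
        intervalIntegral.norm_integral_le_of_norm_le_const fun t ht => by
          replace ht := uIoc_subset_uIcc ht
          rw [norm_smul, hderiv _ le_rfl t ht, norm_div, norm_pow, Real.norm_eq_abs,
            Real.norm_natCast]
          have hxt : |x - t| ≤ |x - x₀| := abs_sub_right_of_mem_uIcc ht
          gcongr
          exact hK t ht
    _ = K / n ! * |x - x₀| ^ (n + 1) := by ring

theorem hasSum_iteratedDeriv_of_norm_le {x₀ x A C : ℝ} (hC : 0 ≤ C) (hx : C * |x - x₀| < 1)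
    (hg : ∀ t ∈ [[x₀, x]], ContDiffAt ℝ ∞ g t)
    (hb : ∀ t ∈ [[x₀, x]], ∀ k, ‖iteratedDeriv k g t‖ ≤ A * C ^ k * k !) :
    HasSum (fun k => ((k ! : ℝ)⁻¹ * (x - x₀) ^ k) • iteratedDeriv k g x₀) (g x) := by
  have hq : 0 ≤ C * |x - x₀| := by positivity
  have hsummable : Summable fun k => ((k ! : ℝ)⁻¹ * (x - x₀) ^ k) • iteratedDeriv k g x₀ := by
    refine .of_norm_bounded ((summable_geometric_of_lt_one hq hx).mul_left A) fun k => ?_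
    calc ‖((k ! : ℝ)⁻¹ * (x - x₀) ^ k) • iteratedDeriv k g x₀‖
        ≤ (k ! : ℝ)⁻¹ * |x - x₀| ^ k * (A * C ^ k * k !) := by
          rw [norm_smul, norm_mul, norm_inv, norm_pow, Real.norm_natCast, Real.norm_eq_abs]
          gcongr
          exact hb x₀ left_mem_uIcc k
      _ = A * (C * |x - x₀|) ^ k := by rw [mul_pow]; field_simp
  rw [hsummable.hasSum_iff_tendsto_nat, ← tendsto_add_atTop_iff_nat 1,
    tendsto_iff_norm_sub_tendsto_zero]
  have hremainder : Tendsto (fun n : ℕ => A * (((n + 1 : ℕ) : ℝ) * (C * |x - x₀|) ^ (n + 1)))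
      atTop (𝓝 0) := by
    simpa using ((tendsto_add_atTop_iff_nat 1).2
      (tendsto_self_mul_const_pow_of_lt_one hq hx)).const_mul A
  refine squeeze_zero (fun _ => norm_nonneg _) (fun n => ?_) hremainder
  rw [norm_sub_rev]
  calc _ ≤ A * C ^ (n + 1) * (n + 1)! / n ! * |x - x₀| ^ (n + 1) :=
        norm_sub_sum_iteratedDeriv_le (fun t ht => (hg t ht).of_le (mod_cast le_top))
          fun t ht => hb t ht (n + 1)
    _ = A * (((n + 1 : ℕ) : ℝ) * (C * |x - x₀|) ^ (n + 1)) := by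
        rw [Nat.factorial_succ, mul_pow]; push_cast; field_simp

theorem analyticAt_of_eventually_norm_iteratedDeriv_le {x₀ A C : ℝ} (hC : 0 ≤ C)
    (hg : ∀ᶠ t in 𝓝 x₀, ContDiffAt ℝ ∞ g t)
    (hb : ∀ᶠ t in 𝓝 x₀, ∀ k, ‖iteratedDeriv k g t‖ ≤ A * C ^ k * k !) : AnalyticAt ℝ g x₀ := by
  have hnear : ∀ᶠ x in 𝓝 x₀, C * |x - x₀| < 1 :=
    (show Continuous fun x => C * |x - x₀| by fun_prop).continuousAt.eventually_lt
      continuousAt_const (by simp)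
  obtain ⟨δ, hδ, hball⟩ := Metric.eventually_nhds_iff_ball.1 (hg.and hb)
  refine ⟨fun k => .mkPiRing ℝ (Fin k) ((k ! : ℝ)⁻¹ • iteratedDeriv k g x₀),
    hasFPowerSeriesAt_iff'.2 ?_⟩
  filter_upwards [hnear, Metric.ball_mem_nhds x₀ hδ] with x hx hxδ
  have hsub : [[x₀, x]] ⊆ Metric.ball x₀ δ := by
    rw [← segment_eq_uIcc]
    exact (convex_ball x₀ δ).segment_subset (Metric.mem_ball_self hδ) hxδ
  convert hasSum_iteratedDeriv_of_norm_le hC hx (fun t ht => (hball t (hsub ht)).1)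
    fun t ht => (hball t (hsub ht)).2 using 2 with k
  simp [FormalMultilinearSeries.coeff, smul_smul, mul_comm]

end OneVariable

section IntegralCurve

variable {E F : Type*} [NormedAddCommGroup E] [NormedSpace ℝ E]
  [NormedAddCommGroup F] [NormedSpace ℝ F] {f : E → E} {u : E → F} {γ : ℝ → E}
  {V : Set E} {T : Set ℝ}

theorem hasDerivWithinAt_comp_iterate_lieDeriv (hV : IsOpen V) (hf : ContDiffOn ℝ ∞ f V)
    (hu : ContDiffOn ℝ ∞ u V) (hγ : IsIntegralCurveOn γ (fun _ => f) T) {t : ℝ} (ht : t ∈ T)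
    (hγt : γ t ∈ V) (k : ℕ) :
    HasDerivWithinAt ((lieDeriv f)^[k] u ∘ γ) ((lieDeriv f)^[k + 1] u (γ t)) T t := by
  have hdiff : DifferentiableAt ℝ ((lieDeriv f)^[k] u) (γ t) :=
    ((contDiffOn_iterate_lieDeriv hV hf hu k).differentiableOn (by simp)).differentiableAt
      (hV.mem_nhds hγt)
  rw [Function.iterate_succ_apply']
  exact hdiff.hasFDerivAt.comp_hasDerivWithinAt t (hγ t ht)

theorem eqOn_iteratedDerivWithin_comp_iterate_lieDeriv (hV : IsOpen V) (hT : UniqueDiffOn ℝ T)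
    (hf : ContDiffOn ℝ ∞ f V) (hu : ContDiffOn ℝ ∞ u V)
    (hγ : IsIntegralCurveOn γ (fun _ => f) T) (hγV : MapsTo γ T V) (k : ℕ) :
    EqOn (iteratedDerivWithin k (u ∘ γ) T) ((lieDeriv f)^[k] u ∘ γ) T := by
  induction k with
  | zero => simp [EqOn]
  | succ k ih =>
    intro t ht
    rw [iteratedDerivWithin_succ, derivWithin_congr ih (ih ht)]
    exact (hasDerivWithinAt_comp_iterate_lieDeriv hV hf hu hγ ht (hγV ht) k).derivWithin (hT t ht)

theorem contDiffOn_comp_of_isIntegralCurveOn (hV : IsOpen V) (hT : UniqueDiffOn ℝ T)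
    (hf : ContDiffOn ℝ ∞ f V) (hu : ContDiffOn ℝ ∞ u V)
    (hγ : IsIntegralCurveOn γ (fun _ => f) T) (hγV : MapsTo γ T V) :
    ContDiffOn ℝ ∞ (u ∘ γ) T :=
  contDiffOn_of_differentiableOn_deriv fun k _ => DifferentiableOn.congr
    (fun _ ht => (hasDerivWithinAt_comp_iterate_lieDeriv hV hf hu hγ ht (hγV ht)
      k).differentiableWithinAt)
    (eqOn_iteratedDerivWithin_comp_iterate_lieDeriv hV hT hf hu hγ hγV k)

theorem HasCauchyEstimatesOn.analyticOnNhd_comp [CompleteSpace F] {A M R : ℝ}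
    (hu : HasCauchyEstimatesOn u V A R 0) (hf : HasCauchyEstimatesOn f V M (R / 2) 0)
    (hR : 0 ≤ R) (hV : IsOpen V) (hT : IsOpen T) (hfV : ContDiffOn ℝ ∞ f V)
    (huV : ContDiffOn ℝ ∞ u V) (hγ : IsIntegralCurveOn γ (fun _ => f) T) (hγV : MapsTo γ T V) :
    AnalyticOnNhd ℝ (u ∘ γ) T := by
  intro t₀ ht₀
  have hM : 0 ≤ M := hf.nonneg (hγV ht₀)
  refine analyticAt_of_eventually_norm_iteratedDeriv_le (A := A) (C := 2 * M * R) (by positivity)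
    ?_ ?_ <;> filter_upwards [hT.mem_nhds ht₀] with t ht
  · exact (contDiffOn_comp_of_isIntegralCurveOn hV hT.uniqueDiffOn hfV huV hγ hγV).contDiffAt
      (hT.mem_nhds ht)
  · intro k
    rw [← iteratedDerivWithin_of_isOpen hT ht,
      eqOn_iteratedDerivWithin_comp_iterate_lieDeriv hV hT.uniqueDiffOn hfV huV hγ hγV k ht]
    simpa using hu.iterate_lieDeriv hf hR hV hfV huV k (γ t) (hγV ht) 0

theorem analyticAt_of_isIntegralCurveAt [CompleteSpace E] {t₀ : ℝ}
    (hf : AnalyticAt ℝ f (γ t₀)) (hγ : IsIntegralCurveAt γ (fun _ => f) t₀) :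
    AnalyticAt ℝ γ t₀ := by
  obtain ⟨M, R₁, hR₁, V₁, hV₁, hfV₁⟩ := exists_hasCauchyEstimatesOn_of_analyticAt hf
  obtain ⟨A, R₂, hR₂, V₂, hV₂, hidV₂⟩ := exists_hasCauchyEstimatesOn_of_analyticAt
    (analyticAt_id (𝕜 := ℝ) (E := E) (z := γ t₀))
  obtain ⟨V, hVsub, hV, hmem⟩ := mem_nhds_iff.1
    (inter_mem (inter_mem hV₁ hV₂) hf.eventually_analyticAt)
  obtain ⟨T, hTsub, hT, ht₀⟩ := mem_nhds_iff.1
    (inter_mem hγ (hγ.continuousAt.preimage_mem_nhds (hV.mem_nhds hmem)))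
  have hfV : HasCauchyEstimatesOn f V M ((2 * R₁ + R₂) / 2) 0 :=
    hfV₁.mono (fun y hy => (hVsub hy).1.1) hR₁.le (by linarith)
  have hidV : HasCauchyEstimatesOn id V A (2 * R₁ + R₂) 0 :=
    hidV₂.mono (fun y hy => (hVsub hy).1.2) hR₂.le (by linarith)
  exact hidV.analyticOnNhd_comp hfV (by positivity) hV hT
    (fun y hy => (hVsub hy).2.contDiffAt.contDiffWithinAt) contDiffOn_id
    (fun t ht => (hTsub ht).1.hasDerivWithinAt) (fun t ht => (hTsub ht).2) t₀ ht₀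

end IntegralCurve

section Semianalytic

theorem eventually_neg_of_frequently_neg_of_analyticAt {g : ℝ → ℝ} {t₀ : ℝ}
    (hg : AnalyticAt ℝ g t₀) (h : ∃ᶠ t in 𝓝[>] t₀, g t < 0) : ∀ᶠ t in 𝓝[>] t₀, g t < 0 := by
  have hne : ¬ ∀ᶠ t in 𝓝 t₀, g t = 0 := fun h0 => by
    obtain ⟨t, ht, ht0⟩ := (h.and_eventually (h0.filter_mono nhdsWithin_le_nhds)).exists
    exact ht.ne ht0
  obtain ⟨n, g', hg', hg'0, hfactor⟩ := hg.exists_eventuallyEq_pow_smul_nonzero_iff.2 hne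
  have hsign : ∀ᶠ t in 𝓝[>] t₀, (g t < 0 ↔ g' t < 0) := by
    filter_upwards [hfactor.filter_mono nhdsWithin_le_nhds, self_mem_nhdsWithin] with t ht htpos
    rw [ht, smul_neg_iff_of_pos_left (pow_pos (sub_pos.2 htpos) n)]
  rw [frequently_congr hsign] at h
  rw [eventually_congr hsign]
  have hcont : Tendsto g' (𝓝[>] t₀) (𝓝 (g' t₀)) := hg'.continuousAt.tendsto.mono_left inf_le_left
  refine hcont.eventually_lt_const (hg'0.lt_of_le (le_of_not_gt fun hpos => ?_))
  obtain ⟨t, ht, ht'⟩ := (h.and_eventually (hcont.eventually_const_lt hpos)).exists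
  exact ht.not_gt ht'

theorem IsSemianalytic.eventually_mem_of_frequently_mem {E : Type*} [NormedAddCommGroup E]
    [NormedSpace ℝ E] {S : Set E} (hS : IsSemianalytic S) {γ : ℝ → E} {t₀ : ℝ}
    (hγ : AnalyticAt ℝ γ t₀) (h : ∃ᶠ t in 𝓝[>] t₀, γ t ∈ S) :
    ∀ᶠ t in 𝓝[>] t₀, γ t ∈ S := by
  obtain ⟨U, hU, hmem, C, hC, hSU⟩ := hS (γ t₀)
  have hγU : ∀ᶠ t in 𝓝[>] t₀, γ t ∈ U :=
    (hγ.continuousAt.eventually_mem (hU.mem_nhds hmem)).filter_mono nhdsWithin_le_nhds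
  obtain ⟨c, hc, hfreq⟩ := (frequently_exists_finset C).1 <|
    (h.and_eventually hγU).mono fun t ht => (hSU _ ht.2).1 ht.1
  have hneg : ∀ p ∈ c.1, ∀ᶠ t in 𝓝[>] t₀, p (γ t) < 0 := fun p hp =>
    eventually_neg_of_frequently_neg_of_analyticAt (((hC c hc).1 p hp _ hmem).comp hγ)
      (hfreq.mono fun t ht => ht.1 p hp)
  have hzero : ∀ q ∈ c.2, ∀ᶠ t in 𝓝[>] t₀, q (γ t) = 0 := fun q hq =>
    ((((hC c hc).2 q hq _ hmem).comp hγ).frequently_zero_iff_eventually_zero.1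
      ((hfreq.mono fun t ht => ht.2 q hq).filter_mono (nhdsGT_le_nhdsNE t₀))).filter_mono
      nhdsWithin_le_nhds
  filter_upwards [hγU, (eventually_all_finset c.1).2 hneg, (eventually_all_finset c.2).2 hzero]
    with t htU htneg htzero
  exact (hSU _ htU).2 ⟨c, hc, htneg, htzero⟩

end Semianalytic

section Flow

variable {E : Type*} [NormedAddCommGroup E] [NormedSpace ℝ E] {f : E → E} {x : E}
  {a b : ℝ} {γ : ℝ → E} {S S₁ S₂ : Set E}

theorem exitSet_eq_diff_inSet (f : E → E) (S : Set E) : exitSet f S = S \ inSet f S := by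
  ext x
  simp only [exitSet, inSet, Set.mem_sdiff, mem_ofPred_eq]
  push Not
  rfl

theorem inSet_mono (h : S₁ ⊆ S₂) : inSet f S₁ ⊆ inSet f S₂ :=
  fun _ ⟨ε, hε, hε0, hS⟩ => ⟨ε, hε, hε0, fun t ht => h (hS t ht)⟩

theorem exitSet_inter_compl_union_compl_inter_exitSet (f : E → E) (S₁ S₂ : Set E) :
    (exitSet f S₁ ∩ (inSet f S₂)ᶜ) ∪ ((inSet f S₁)ᶜ ∩ exitSet f S₂) =
      (S₁ ∪ S₂) \ (inSet f S₁ ∪ inSet f S₂) := by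
  ext x
  simp only [exitSet_eq_diff_inSet, mem_union, mem_inter_iff, Set.mem_sdiff, mem_compl_iff]
  tauto

theorem exitSet_union_subset (f : E → E) (S₁ S₂ : Set E) :
    exitSet f (S₁ ∪ S₂) ⊆
      (exitSet f S₁ ∩ (inSet f S₂)ᶜ) ∪ ((inSet f S₁)ᶜ ∩ exitSet f S₂) := by
  rw [exitSet_inter_compl_union_compl_inter_exitSet, exitSet_eq_diff_inSet]
  exact sdiff_subset_sdiff_right
    (union_subset (inSet_mono subset_union_left) (inSet_mono subset_union_right))

namespace IsSolution

theorem mem_maxInterval (h : IsSolution f x a b γ) {t : ℝ} (ht : t ∈ Ioo a b) :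
    t ∈ maxInterval f x :=
  ⟨γ, a, b, ht, h⟩

theorem restrict (h : IsSolution f x a b γ) {a' b' : ℝ} (ha' : a' < 0) (hb' : 0 < b')
    (hsub : Ioo a' b' ⊆ Ioo a b) : IsSolution f x a' b' γ :=
  ⟨ha', hb', h.2.2.1, fun t ht => h.2.2.2 t (hsub ht)⟩

theorem mem_inSet_iff (h : IsSolution f x a b γ) :
    x ∈ inSet f S ↔ ∀ᶠ t in 𝓝[>] 0, flow f t x ∈ S := by
  have hmax : ∀ᶠ ε in 𝓝[>] 0, ε ∈ maxInterval f x :=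
    nhdsWithin_le_nhds (mem_of_superset (Ioo_mem_nhds h.1 h.2.1) fun _ => h.mem_maxInterval)
  refine ⟨fun ⟨ε, _, hε, hS⟩ => mem_of_superset (Ioo_mem_nhdsGT hε) hS, fun hS => ?_⟩
  obtain ⟨δ, hδ, hδS⟩ := mem_nhdsGT_iff_exists_Ioo_subset.1 hS
  obtain ⟨ε, hε, hε0, hεδ⟩ := (hmax.and (Ioo_mem_nhdsGT hδ)).exists
  exact ⟨ε, hε, hε0, fun t ht => hδS ⟨ht.1, ht.2.trans hεδ⟩⟩

theorem eqOn_flow (h : IsSolution f x a b γ) (hf : HasUniqueSolutions f) :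
    EqOn (fun t => flow f t x) γ (Ioo a b) := by
  intro t ht
  have hmem := h.mem_maxInterval ht
  obtain ⟨a', b', ht', h'⟩ := hmem.choose_spec
  simp only [flow, dif_pos hmem]
  refine (hf x).2 (max a' a) (min b' b) _ _ ?_ ?_ ⟨max_lt ht'.1 ht.1, lt_min ht'.2 ht.2⟩
  · exact h'.restrict (max_lt h'.1 h.1) (lt_min h'.2.1 h.2.1)
      (Ioo_subset_Ioo (le_max_left _ _) (min_le_left _ _))
  · exact h.restrict (max_lt h'.1 h.1) (lt_min h'.2.1 h.2.1)
      (Ioo_subset_Ioo (le_max_right _ _) (min_le_right _ _))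

end IsSolution

namespace HasUniqueSolutions

theorem mem_inSet_iff (hf : HasUniqueSolutions f) :
    x ∈ inSet f S ↔ ∀ᶠ t in 𝓝[>] 0, flow f t x ∈ S :=
  let ⟨_, _, _, h⟩ := (hf x).1
  h.mem_inSet_iff

theorem flow_zero (hf : HasUniqueSolutions f) (x : E) : flow f 0 x = x :=
  let ⟨_, _, _, h⟩ := (hf x).1
  (h.eqOn_flow hf ⟨h.1, h.2.1⟩).trans h.2.2.1

theorem isIntegralCurveAt_flow (hf : HasUniqueSolutions f) (x : E) :
    IsIntegralCurveAt (fun t => flow f t x) (fun _ => f) 0 := by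
  obtain ⟨a, b, γ, h⟩ := (hf x).1
  filter_upwards [Ioo_mem_nhds h.1 h.2.1] with t ht
  have heq : flow f t x = γ t := h.eqOn_flow hf ht
  rw [heq]
  exact (h.2.2.2 t ht).congr_of_eventuallyEq
    ((h.eqOn_flow hf).eventuallyEq_of_mem (Ioo_mem_nhds ht.1 ht.2))

end HasUniqueSolutions

theorem IsSolution.isMIntegralCurveOn (h : IsSolution f x a b γ) :
    IsMIntegralCurveOn (I := 𝓘(ℝ, E)) γ f (Ioo a b) := fun t ht =>
  (h.2.2.2 t ht).hasFDerivAt.hasMFDerivAt.hasMFDerivWithinAt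

theorem hasUniqueSolutions_of_contDiff [CompleteSpace E] (hf : ContDiff ℝ 1 f) :
    HasUniqueSolutions f := fun x => by
  refine ⟨?_, fun a b γ₁ γ₂ h₁ h₂ => ?_⟩
  · obtain ⟨γ, h0, ε, hε, hγ⟩ :=
      hf.contDiffAt.exists_forall_mem_closedBall_exists_eq_forall_mem_Ioo_hasDerivAt₀ (x₀ := x) 0
    exact ⟨0 - ε, 0 + ε, γ, by linarith, by linarith, h0, hγ⟩
  · exact isMIntegralCurveOn_Ioo_eqOn_of_contMDiff_boundaryless (I := 𝓘(ℝ, E)) ⟨h₁.1, h₁.2.1⟩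
      (contMDiff_vectorSpace_iff_contDiff.2 hf) h₁.isMIntegralCurveOn h₂.isMIntegralCurveOn
      (h₁.2.2.1.trans h₂.2.2.1.symm)

end Flow

section Union

variable {E : Type*} [NormedAddCommGroup E] [NormedSpace ℝ E] [CompleteSpace E] {f : E → E}
  {S₁ : Set E}

theorem hasUniqueSolutions_of_analyticOnNhd (hf : AnalyticOnNhd ℝ f univ) :
    HasUniqueSolutions f :=
  hasUniqueSolutions_of_contDiff (contDiff_iff_contDiffAt.2 fun x => (hf x (mem_univ x)).contDiffAt)

theorem inSet_union_of_isSemianalytic (hf : AnalyticOnNhd ℝ f univ) (hS₁ : IsSemianalytic S₁)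
    (S₂ : Set E) : inSet f (S₁ ∪ S₂) = inSet f S₁ ∪ inSet f S₂ := by
  refine Subset.antisymm (fun x hx => ?_)
    (union_subset (inSet_mono subset_union_left) (inSet_mono subset_union_right))
  have huniq := hasUniqueSolutions_of_analyticOnNhd hf
  have hflow : AnalyticAt ℝ (fun t => flow f t x) 0 :=
    analyticAt_of_isIntegralCurveAt (hf _ (mem_univ _)) (huniq.isIntegralCurveAt_flow x)
  simp only [mem_union, huniq.mem_inSet_iff] at hx ⊢
  by_cases hfreq : ∃ᶠ t in 𝓝[>] 0, flow f t x ∈ S₁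
  · exact Or.inl (hS₁.eventually_mem_of_frequently_mem hflow hfreq)
  · exact Or.inr ((hx.and (not_frequently.1 hfreq)).mono fun t ht => ht.1.resolve_left ht.2)

theorem exitSet_union_of_isSemianalytic (hf : AnalyticOnNhd ℝ f univ) (hS₁ : IsSemianalytic S₁)
    (S₂ : Set E) :
    exitSet f (S₁ ∪ S₂) =
      (exitSet f S₁ ∩ (inSet f S₂)ᶜ) ∪ ((inSet f S₁)ᶜ ∩ exitSet f S₂) := by
  rw [exitSet_eq_diff_inSet, inSet_union_of_isSemianalytic hf hS₁,
    exitSet_inter_compl_union_compl_inter_exitSet]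

end Union

section Counterexample

variable {E : Type*} [NormedAddCommGroup E] [NormedSpace ℝ E] {f : E → E} {x : E}

theorem frequently_nhdsGT_mem_of_dense {D : Set ℝ} (hD : Dense D) {u : ℝ → ℝ} {t₀ : ℝ}
    (hu : ∀ᶠ t in 𝓝 t₀, ContinuousAt u t) (hne : ∃ᶠ t in 𝓝[>] t₀, u t ≠ u t₀) :
    ∃ᶠ t in 𝓝[>] t₀, u t ∈ D := by
  rw [(nhdsGT_basis t₀).frequently_iff] at hne ⊢
  intro b hb
  obtain ⟨δ, hδ, hcont⟩ := Metric.eventually_nhds_iff_ball.1 hu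
  obtain ⟨t, ht, hut⟩ := hne (min b (t₀ + δ)) (lt_min hb (by linarith))
  have htball : t ∈ Metric.ball t₀ δ := by
    rw [Real.ball_eq_Ioo]
    exact ⟨by linarith [ht.1], ht.2.trans_le (min_le_right _ _)⟩
  have hcontOn : ContinuousOn u [[t₀, t]] := fun s hs =>
    (hcont s ((convex_ball t₀ δ).ordConnected.uIcc_subset (Metric.mem_ball_self hδ) htball
      hs)).continuousWithinAt
  obtain ⟨d, hd, hdD⟩ := hD.inter_open_nonempty _ isOpen_Ioo
    (nonempty_Ioo.2 (inf_lt_sup.2 hut.symm))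
  obtain ⟨s, hs, rfl⟩ := intermediate_value_uIcc hcontOn (Ioo_subset_Icc_self hd)
  rw [uIcc_of_le ht.1.le] at hs
  have hs₀ : t₀ ≠ s := by
    rintro rfl
    exact left_notMem_uIoo hd
  exact ⟨s, ⟨hs.1.lt_of_ne hs₀, hs.2.trans_lt (ht.2.trans_le (min_le_left _ _))⟩, hdD⟩

theorem HasUniqueSolutions.frequently_apply_flow_mem_of_dense (hf : HasUniqueSolutions f)
    (l : E →L[ℝ] ℝ) (hl : l (f x) ≠ 0) {D : Set ℝ} (hD : Dense D) :
    ∃ᶠ t in 𝓝[>] 0, l (flow f t x) ∈ D := by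
  have hcurve := hf.isIntegralCurveAt_flow x
  have hderiv : HasDerivAt (fun t => l (flow f t x)) (l (f (flow f 0 x))) 0 :=
    l.hasFDerivAt.comp_hasDerivAt 0 hcurve.self_of_nhds
  rw [hf.flow_zero] at hderiv
  refine frequently_nhdsGT_mem_of_dense hD (hcurve.mono fun t ht => ?_)
    ((hderiv.eventually_ne hl).filter_mono (nhdsGT_le_nhdsNE 0)).frequently
  exact l.continuous.continuousAt.comp ht.continuousAt

theorem HasUniqueSolutions.notMem_inSet_preimage (hf : HasUniqueSolutions f)
    (l : E →L[ℝ] ℝ) (hl : l (f x) ≠ 0) {D : Set ℝ} (hD : Dense Dᶜ) : x ∉ inSet f (l ⁻¹' D) := by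
  rw [hf.mem_inSet_iff, not_eventually]
  exact hf.frequently_apply_flow_mem_of_dense l hl hD

theorem exists_not_subset_exitSet_union (hf : HasUniqueSolutions f) (hx : f x ≠ 0) :
    ∃ S₁ S₂ : Set E,
      ¬ ((exitSet f S₁ ∩ (inSet f S₂)ᶜ) ∪ ((inSet f S₁)ᶜ ∩ exitSet f S₂) ⊆
        exitSet f (S₁ ∪ S₂)) := by
  obtain ⟨l, hl⟩ := SeparatingDual.exists_ne_zero (R := ℝ) hx
  let Q : Set ℝ := range ((↑) : ℚ → ℝ)
  have hQ : x ∉ inSet f (l ⁻¹' Q) := hf.notMem_inSet_preimage l hl dense_irrational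
  have hQc : x ∉ inSet f (l ⁻¹' Qᶜ) :=
    hf.notMem_inSet_preimage l hl (by rw [compl_compl]; exact Rat.denseRange_cast)
  have huniv : x ∈ inSet f univ := hf.mem_inSet_iff.2 (Eventually.of_forall fun _ => mem_univ _)
  refine ⟨l ⁻¹' Q, l ⁻¹' Qᶜ, fun hsub => ?_⟩
  rw [exitSet_inter_compl_union_compl_inter_exitSet, exitSet_eq_diff_inSet, preimage_compl,
    union_compl_self] at hsub
  exact (hsub ⟨mem_univ x, not_or.2 ⟨hQ, hQc⟩⟩).2 huniv

end Counterexample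

theorem mainTheorem7_general {E : Type*} [NormedAddCommGroup E] [NormedSpace ℝ E]
    [CompleteSpace E] :
    (∀ f : E → E, AnalyticOnNhd ℝ f univ → ∀ S₁ S₂ : Set E, IsSemianalytic S₁ →
      exitSet f (S₁ ∪ S₂) =
        (exitSet f S₁ ∩ (inSet f S₂)ᶜ) ∪ ((inSet f S₁)ᶜ ∩ exitSet f S₂)) ∧
    (∀ f : E → E, HasUniqueSolutions f → ∀ S₁ S₂ : Set E,
      exitSet f (S₁ ∪ S₂) ⊆
        (exitSet f S₁ ∩ (inSet f S₂)ᶜ) ∪ ((inSet f S₁)ᶜ ∩ exitSet f S₂)) ∧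
    (∀ f : E → E, HasUniqueSolutions f → (∃ x, f x ≠ 0) → ∃ S₁ S₂ : Set E,
      ¬ ((exitSet f S₁ ∩ (inSet f S₂)ᶜ) ∪ ((inSet f S₁)ᶜ ∩ exitSet f S₂) ⊆
        exitSet f (S₁ ∪ S₂))) :=
  ⟨fun _ hf _ S₂ hS₁ => exitSet_union_of_isSemianalytic hf hS₁ S₂,
    fun f _ => exitSet_union_subset f,
    fun _ hf ⟨_, hx⟩ => exists_not_subset_exitSet_union hf hx⟩

theorem mainTheorem7 :
    -- equality for semi-analytic sets and real analytic systems
    (∀ (n : ℕ) (f : EuclideanSpace ℝ (Fin n) → EuclideanSpace ℝ (Fin n)),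
      AnalyticOnNhd ℝ f Set.univ →
      ∀ S₁ S₂ : Set (EuclideanSpace ℝ (Fin n)), IsSemianalytic S₁ → IsSemianalytic S₂ →
        exitSet f (S₁ ∪ S₂) =
          (exitSet f S₁ ∩ (inSet f S₂)ᶜ) ∪ ((inSet f S₁)ᶜ ∩ exitSet f S₂)) ∧
    -- inclusion for arbitrary sets and arbitrary systems with unique solutions
    (∀ (n : ℕ) (f : EuclideanSpace ℝ (Fin n) → EuclideanSpace ℝ (Fin n)),
      Continuous f → HasUniqueSolutions f →
      ∀ S₁ S₂ : Set (EuclideanSpace ℝ (Fin n)),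
        exitSet f (S₁ ∪ S₂) ⊆
          (exitSet f S₁ ∩ (inSet f S₂)ᶜ) ∪ ((inSet f S₁)ᶜ ∩ exitSet f S₂)) ∧
    -- the reverse inclusion fails for arbitrary sets, already for the system `x' = 1` on the line
    (∃ S₁ S₂ : Set (EuclideanSpace ℝ (Fin 1)),
      ¬ ((exitSet (fun _ => !₂[(1 : ℝ)]) S₁ ∩ (inSet (fun _ => !₂[(1 : ℝ)]) S₂)ᶜ) ∪
            ((inSet (fun _ => !₂[(1 : ℝ)]) S₁)ᶜ ∩ exitSet (fun _ => !₂[(1 : ℝ)]) S₂) ⊆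
          exitSet (fun _ => !₂[(1 : ℝ)]) (S₁ ∪ S₂))) := by
  exact ⟨fun n f hf S₁ S₂ hS₁ _ => mainTheorem7_general.1 f hf S₁ S₂ hS₁,
    fun n f _ hf => mainTheorem7_general.2.1 f hf,
    mainTheorem7_general.2.2 _ (hasUniqueSolutions_of_contDiff contDiff_const) ⟨0, by simp⟩⟩
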